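/- Let $d\ge 1$, let $v:\mathbb R^d\to\mathbb R^d$ be Lipschitz and uniformly bounded, with flow $\Phi_t^v$ ($t\in\mathbb R$), i.e. $t\mapsto\Phi^v_t(x)$ is the solution of $\dot x(t)=v(x(t))$, $x(0)=x$, and let $\omega\subset\mathbb R^d$ be a nonempty open connected set. Let $\mu^0,\mu^1$ be two compactly supported Borel probability measures on $\mathbb R^d$ (not necessarily absolutely continuous) satisfying the geometrical condition: (i) for each $x^0\in\operatorname{supp}(\mu^0)$ there exists $t^0>0$ such that $\Phi^v_{t^0}(x^0)\in\omega$; (ii) for each $x^1\in\operatorname{supp}(\mu^1)$ there exists $t^1>0$ such that $\Phi^v_{-t^1}(x^1)\in\omega$. Then there exists $T>0$ such that the system $$\partial_t\mu+\nabla\cdot\big((v+\mathbf 1_\omega u)\mu\big)=0,\qquad \mu(0)=\mu^0$$ is exactly controllable from $\mu^0$ to $\mu^1$ on $[0,T]$ in the following sense: there exists a pair $(\mathbf 1_\omega u,\mu)$, where $\mathbf 1_\omega u:\mathbb R^d\times\mathbb R^+\to\mathbb R^d$ is a Borel vector field and $\mu=(\mu(t))_{t\in[0,T]}$ is a family of finite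 Borel measures on $\mathbb R^d$ which is a weak solution of the system on $[0,T]$, such that $\mu(T)=\mu^1$. (Uniqueness of the solution for the given control is not asserted.) Here $\mu$ is a weak solution on $[0,T]$ if, with $w:=v+\mathbf 1_\omega u$: $\int_0^T\int_{\mathbb R^d}|w(x,t)|\,d\mu(t)(x)\,dt<\infty$; the function $t\mapsto\int\xi\,d\mu(t)$ is continuous on $[0,T]$ for every continuous bounded $\xi:\mathbb R^d\to\mathbb R$, and absolutely continuous on $[0,T]$ for every bounded Lipschitz $\xi$; for every $\psi\in C_c^\infty(\mathbb R^d)$, $$\frac{d}{dt}\int_{\mathbb R^d}\psi\,d\mu(t)=\int_{\mathbb R^d}\langle\nabla\psi(x),w(x,t)\rangle\,d\mu(t)(x)\quad\text{for a.e. }t\in(0,T);$$ and $\mu(0)=\mu^0$. -/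

import Mathlib

open MeasureTheory Set

section Flow

variable {E : Type*} [NormedAddCommGroup E] [NormedSpace ℝ E]

open Classical in
/-- The flow `Φ_t^v(x)` of an autonomous vector field `v`, for all (positive and negative) times
`t`: the value at time `t` of the solution `γ : ℝ → E` of `γ' = v(γ)`, `γ(0) = x`.
For a bounded Lipschitz field `v` on a complete space this solution exists (`flow_spec`) and is
unique (`flow_eq`); the default value `x` is used only if there is no global solution. -/
noncomputable def flow (v : E → E) (t : ℝ) (x : E) : E :=
  if h : ∃ γ : ℝ → E, γ 0 = x ∧ IsIntegralCurve γ (fun _ => v) then h.choose t else x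

/-- Global Cauchy-Lipschitz theorem for bounded Lipschitz vector fields. -/
theorem exists_global_integralCurve [CompleteSpace E] {v : E → E} {K : NNReal}
    (hv : LipschitzWith K v) {C : ℝ} (hC : ∀ x, ‖v x‖ ≤ C) (x : E) :
    ∃ γ : ℝ → E, γ 0 = x ∧ IsIntegralCurve γ (fun _ => v) := by
  have hC0 : 0 ≤ C := (norm_nonneg _).trans (hC x)
  have key : ∀ n : ℕ, ∃ α : ℝ → E, α 0 = x ∧
      ∀ t ∈ Ioo (-(n : ℝ)) n, HasDerivAt α (v (α t)) t := by
    intro n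
    have hn : (0 : ℝ) ≤ n := n.cast_nonneg
    have hmem : (0 : ℝ) ∈ Icc (-(n : ℝ)) n := ⟨by linarith, hn⟩
    have hp : IsPicardLindelof (fun _ => v) (tmin := -(n : ℝ)) (tmax := n) ⟨0, hmem⟩ x
        (C.toNNReal * n) 0 C.toNNReal K := by
      refine IsPicardLindelof.of_time_independent (fun y _ => ?_) hv.lipschitzOnWith ?_
      · rw [Real.coe_toNNReal C hC0]
        exact hC y
      · simp
    obtain ⟨α, h0, hα⟩ := hp.exists_eq_forall_mem_Icc_hasDerivWithinAt₀
    exact ⟨α, h0, fun t ht =>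
      (hα t (Ioo_subset_Icc_self ht)).hasDerivAt (Icc_mem_nhds ht.1 ht.2)⟩
  choose α h0 hα using key
  have agree : ∀ m n : ℕ, 1 ≤ m → m ≤ n → EqOn (α m) (α n) (Ioo (-(m : ℝ)) m) := by
    intro m n hm hmn
    have hm' : (1 : ℝ) ≤ m := by exact_mod_cast hm
    have hmn' : (m : ℝ) ≤ n := by exact_mod_cast hmn
    refine ODE_solution_unique_of_mem_Ioo (v := fun _ => v) (s := fun _ => univ) (t₀ := 0)
      (fun t _ => hv.lipschitzOnWith) ⟨by linarith, by linarith⟩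
      (fun t ht => ⟨hα m t ht, mem_univ _⟩)
      (fun t ht => ⟨hα n t ⟨by linarith [ht.1], by linarith [ht.2]⟩, mem_univ _⟩)
      ((h0 m).trans (h0 n).symm)
  let N : ℝ → ℕ := fun t => ⌈|t|⌉₊ + 1
  have hN : ∀ t, |t| < N t := by
    intro t
    have := Nat.le_ceil |t|
    simp only [N]
    push_cast
    linarith
  refine ⟨fun t => α (N t) t, h0 _, fun t => ?_⟩
  have hev : (fun s => α (N s) s) =ᶠ[nhds t] α (N t + 1) := by
    have ht : t ∈ Ioo (-(N t : ℝ)) (N t) := abs_lt.mp (hN t)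
    filter_upwards [Ioo_mem_nhds ht.1 ht.2] with s hs
    have hs' : |s| < N t := abs_lt.mpr hs
    have hle : N s ≤ N t + 1 := by
      have : ⌈|s|⌉₊ ≤ N t := Nat.ceil_le.mpr hs'.le
      simp only [N] at this ⊢
      omega
    exact agree (N s) (N t + 1) (by simp [N]) hle (abs_lt.mp (hN s))
  have hd : HasDerivAt (α (N t + 1)) (v (α (N t + 1) t)) t := by
    have := hN t
    refine hα (N t + 1) t (abs_lt.mp ?_)
    push_cast
    linarith
  have := hd.congr_of_eventuallyEq hev
  rwa [← hev.eq_of_nhds] at this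

/-- `t ↦ flow v t x` is the global solution of the Cauchy problem. -/
theorem flow_spec [CompleteSpace E] {v : E → E} {K : NNReal}
    (hv : LipschitzWith K v) {C : ℝ} (hC : ∀ x, ‖v x‖ ≤ C) (x : E) :
    flow v 0 x = x ∧ ∀ t, HasDerivAt (fun s => flow v s x) (v (flow v t x)) t := by
  have h := exists_global_integralCurve hv hC x
  have hfl : (fun s => flow v s x) = h.choose := by
    funext s
    simp only [flow, dif_pos h]
  refine ⟨(congrFun hfl 0).trans h.choose_spec.1, fun t => ?_⟩
  rw [congrFun hfl t, hfl]
  exact h.choose_spec.2 t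

/-- Any global solution of the Cauchy problem is given by the flow. -/
theorem flow_eq {v : E → E} {K : NNReal} (hv : LipschitzWith K v) {x : E} {γ : ℝ → E}
    (h0 : γ 0 = x) (hγ : ∀ t, HasDerivAt γ (v (γ t)) t) (t : ℝ) : flow v t x = γ t := by
  have h : ∃ γ : ℝ → E, γ 0 = x ∧ IsIntegralCurve γ (fun _ => v) := ⟨γ, h0, hγ⟩
  simp only [flow, dif_pos h]
  refine ODE_solution_unique_of_mem_Ioo (v := fun _ => v) (s := fun _ => univ) (t₀ := 0)
    (a := -(|t| + 1)) (b := |t| + 1) (K := K)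
    (fun _ _ => hv.lipschitzOnWith) ⟨by linarith [abs_nonneg t], by linarith [abs_nonneg t]⟩
    (fun s _ => ⟨h.choose_spec.2 s, mem_univ _⟩) (fun s _ => ⟨hγ s, mem_univ _⟩)
    (h.choose_spec.1.trans h0.symm) (abs_lt.mp (by linarith))

end Flow

/-- The geometrical condition: every point of the support of `μ₀` is brought into `ω` by the flow
of `v` in positive time, and every point of the support of `μ₁` is brought into `ω` by the
flow backward in time. -/
def GeometricCondition {d : ℕ} (v : EuclideanSpace ℝ (Fin d) → EuclideanSpace ℝ (Fin d))
    (ω : Set (EuclideanSpace ℝ (Fin d))) (μ₀ μ₁ : Measure (EuclideanSpace ℝ (Fin d))) : Prop :=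
  (∀ x ∈ μ₀.support, ∃ t : ℝ, 0 < t ∧ flow v t x ∈ ω) ∧
    ∀ x ∈ μ₁.support, ∃ t : ℝ, 0 < t ∧ flow v (-t) x ∈ ω

/-- The localized field `𝟙_ω u`. -/
noncomputable def localizedControl {d : ℕ} (ω : Set (EuclideanSpace ℝ (Fin d)))
    (u : EuclideanSpace ℝ (Fin d) → ℝ → EuclideanSpace ℝ (Fin d)) :
    EuclideanSpace ℝ (Fin d) → ℝ → EuclideanSpace ℝ (Fin d) :=
  fun x t => ω.indicator (fun y => u y t) x

/-- `(μ, w)` is a weak solution on `[0, T]` of the continuity equation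
`∂ₜ μ + ∇ · (w μ) = 0`, `μ(0) = μ₀`, where `w` is a Borel vector field and `μ(t)`, `t ∈ [0, T]`,
are finite (nonnegative Borel) measures on `ℝᵈ`. Only the values of `μ` on `[0, T]` matter. -/
structure IsWeakSolution {d : ℕ} (T : ℝ) (μ₀ : Measure (EuclideanSpace ℝ (Fin d)))
    (w : EuclideanSpace ℝ (Fin d) → ℝ → EuclideanSpace ℝ (Fin d))
    (μ : ℝ → Measure (EuclideanSpace ℝ (Fin d))) : Prop where
  /-- The velocity field is Borel in `(x, t)`. -/
  measurable_field : Measurable fun p : EuclideanSpace ℝ (Fin d) × ℝ => w p.1 p.2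
  /-- The measures `μ(t)` are finite. -/
  finite : ∀ t ∈ Icc 0 T, IsFiniteMeasure (μ t)
  /-- `∫₀ᵀ ∫ |w(t)| dμ(t) dt < ∞`. -/
  integrable_field : ∫⁻ t in Icc 0 T, ∫⁻ x, ‖w x t‖ₑ ∂(μ t) < ⊤
  /-- `t ↦ μ(t)` is continuous for the weak convergence (tested by continuous bounded
  functions). -/
  weakly_continuous : ∀ ξ : BoundedContinuousFunction (EuclideanSpace ℝ (Fin d)) ℝ,
    ContinuousOn (fun t => ∫ x, ξ x ∂(μ t)) (Icc 0 T)
  /-- `t ↦ ∫ ξ dμ(t)` is absolutely continuous on `[0, T]` for `ξ` bounded and Lipschitz. -/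
  absolutely_continuous : ∀ ξ : BoundedContinuousFunction (EuclideanSpace ℝ (Fin d)) ℝ,
    (∃ K : NNReal, LipschitzWith K ξ) →
      AbsolutelyContinuousOnInterval (fun t => ∫ x, ξ x ∂(μ t)) 0 T
  /-- `d/dt ∫ ψ dμ(t) = ∫ ⟨∇ψ, w(t)⟩ dμ(t)` for a.e. `t`, for all smooth compactly
  supported `ψ`. -/
  weak_equation : ∀ ψ : EuclideanSpace ℝ (Fin d) → ℝ, ContDiff ℝ (⊤ : ℕ∞) ψ →
    HasCompactSupport ψ → ∀ᵐ t : ℝ, t ∈ Ioo 0 T →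
      HasDerivAt (fun s => ∫ x, ψ x ∂(μ s)) (∫ x, inner ℝ (gradient ψ x) (w x t) ∂(μ t)) t
  /-- The initial condition. -/
  initial : μ 0 = μ₀

/-!
The control is built from individual trajectories. Fix `p ∈ ω`. A point `x` of the support of `μ₀`
can be steered to `p`: it flows along `v` until it is in `ω`, moves to `p` along a path in `ω`
(where the velocity is free, since `ω` is open and connected), and rests at `p`. Nearby points can
be steered by the same recipe, so compactness of the support yields a measurable, uniformly
Lipschitz family of such curves with a common arrival time (`exists_isSteering_of_isCompact`).
Applied to `-v` and `μ₁` and reversed in time, this also steers `p` to every point `y` of the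
support of `μ₁`. Joining the two halves at `p` gives, for each pair `(x, y)`, a curve from `x` to
`y` which follows `v` outside `ω`. Under the product measure `μ₀ ⊗ μ₁` this is a random curve `γ`
whose initial and final laws are `μ₀` and `μ₁`.

Trajectories cross, so `γ` does not come from a flow; but the continuity equation is linear in the
momentum `w μ`, so the laws `μ(t)` of `γ(t)` solve it for the averaged velocity
`w(x, t) = E[γ'(t) | γ(t) = x]`. The conditional expectation is taken jointly in `(γ(t), t)`, with
respect to `dt ⊗ P`, and factored through `(γ(t), t)` (`exists_conditional_field`), which makes `w`
Borel. Since `γ' = v(γ)` outside `ω`, the difference `w - v` may be taken supported in `ω`. The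
weak equation follows by integrating the chain rule for `ψ(γ(t))` and applying Lebesgue's
differentiation theorem (`exists_isWeakSolution_map`).
-/

open Filter Topology

/-! ### Velocities of random Lipschitz curves -/

section RandomCurves

variable {Ω Y E : Type*} [MeasurableSpace Ω] [MeasurableSpace Y]
  [NormedAddCommGroup E] [InnerProductSpace ℝ E] [FiniteDimensional ℝ E]
  [MeasurableSpace E] [BorelSpace E]

/-- The pointwise velocity of a measurable family of Lipschitz curves can be chosen jointly
measurable: it is the limit of difference quotients along `1 / (n + 1)` wherever this limit
exists. -/
theorem exists_measurable_velocity {γ : Ω → ℝ → E} {C : NNReal}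
    (hγ : Measurable fun z : ℝ × Ω => γ z.2 z.1) (hC : ∀ o, LipschitzWith C (γ o)) :
    ∃ b : ℝ × Ω → E, Measurable b ∧ (∀ z, ‖b z‖ ≤ C) ∧
      ∀ o t, DifferentiableAt ℝ (γ o) t → HasDerivAt (γ o) (b (t, o)) t := by
  let q : ℕ → ℝ × Ω → E := fun n z =>
    (1 / ((n : ℝ) + 1))⁻¹ • (γ z.2 (z.1 + 1 / ((n : ℝ) + 1)) - γ z.2 z.1)
  have hq : ∀ n, Measurable (q n) := by
    intro n
    have h1 : Measurable fun z : ℝ × Ω => γ z.2 (z.1 + 1 / ((n : ℝ) + 1)) :=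
      hγ.comp ((measurable_fst.add_const _).prodMk measurable_snd)
    exact (h1.sub hγ).const_smul _
  have hqC : ∀ n z, ‖q n z‖ ≤ C := by
    intro n z
    have hn : (0 : ℝ) < 1 / ((n : ℝ) + 1) := by positivity
    have h1 := (hC z.2).dist_le_mul (z.1 + 1 / ((n : ℝ) + 1)) z.1
    rw [dist_eq_norm, dist_eq_norm, add_sub_cancel_left, Real.norm_of_nonneg hn.le] at h1
    simp only [q]
    rw [norm_smul, norm_inv, Real.norm_of_nonneg hn.le, inv_mul_le_iff₀ hn, mul_comm]
    exact h1
  let S : Set (ℝ × Ω) := {z | ∃ l, Tendsto (fun n => q n z) atTop (𝓝 l)}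
  have hS : MeasurableSet S := measurableSet_exists_tendsto hq
  let b : ℝ × Ω → E := S.indicator fun z => limUnder atTop fun n => q n z
  have hb : ∀ z ∈ S, Tendsto (fun n => q n z) atTop (𝓝 (b z)) := by
    intro z hz
    simp only [b, indicator_of_mem hz]
    exact tendsto_nhds_limUnder hz
  refine ⟨b, ?_, ?_, ?_⟩
  · refine measurable_of_tendsto_metrizable (fun n => (hq n).indicator hS)
      (tendsto_pi_nhds.2 fun z => ?_)
    by_cases hz : z ∈ S
    · simpa only [indicator_of_mem hz] using hb z hz
    · simp only [b, indicator_of_notMem hz]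
      exact tendsto_const_nhds
  · intro z
    by_cases hz : z ∈ S
    · exact le_of_tendsto (hb z hz).norm (Eventually.of_forall fun n => hqC n z)
    · simp [b, indicator_of_notMem hz]
  · intro o t ht
    have hlim : Tendsto (fun n => q n (t, o)) atTop (𝓝 (deriv (γ o) t)) := by
      have h0 : Tendsto (fun n : ℕ => 1 / ((n : ℝ) + 1)) atTop (𝓝[≠] 0) :=
        tendsto_nhdsWithin_iff.2 ⟨tendsto_one_div_add_atTop_nhds_zero_nat,
          Eventually.of_forall fun n => by
            have : (0 : ℝ) < 1 / ((n : ℝ) + 1) := by positivity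
            exact this.ne'⟩
      exact ht.hasDerivAt.tendsto_slope_zero.comp h0
    have := tendsto_nhds_unique (hb (t, o) ⟨_, hlim⟩) hlim
    rw [this]
    exact ht.hasDerivAt

/-- Averaging a vector-valued random variable over the fibres of `G`: the conditional expectation
given `G`, factored through `G`. -/
theorem exists_conditional_field (m : Measure Ω) [IsFiniteMeasure m] {G : Ω → Y}
    (hG : Measurable G) {b : Ω → E} (hb : Integrable b m) :
    ∃ u : Y → E, Measurable u ∧ Integrable (fun z => u (G z)) m ∧
      ∀ (g : Y → E) (c : ℝ), Measurable g → (∀ y, ‖g y‖ ≤ c) →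
        ∫ z, inner ℝ (g (G z)) (b z) ∂m = ∫ z, inner ℝ (g (G z)) (u (G z)) ∂m := by
  have hle : MeasurableSpace.comap G inferInstance ≤ (inferInstance : MeasurableSpace Ω) :=
    hG.comap_le
  obtain ⟨u, hu, hfac⟩ := (stronglyMeasurable_condExp (μ := m) (f := b)
    (m := MeasurableSpace.comap G inferInstance)).measurable.exists_eq_measurable_comp
  refine ⟨u, hu, ?_, fun g c hg hc => ?_⟩
  · have : Integrable (m[b | MeasurableSpace.comap G inferInstance]) m := integrable_condExp
    rwa [hfac] at this
  · have hgG : StronglyMeasurable[MeasurableSpace.comap G inferInstance] (fun z => g (G z)) :=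
      (hg.comp (comap_measurable G)).stronglyMeasurable
    have key : m[fun z => inner ℝ (g (G z)) (b z) | MeasurableSpace.comap G inferInstance] =ᵐ[m]
        fun z => inner ℝ (g (G z)) (m[b | MeasurableSpace.comap G inferInstance] z) :=
      condExp_stronglyMeasurable_bilin_of_bound (innerSL ℝ) hle hgG hb c
        (ae_of_all _ fun z => hc (G z))
    rw [← integral_condExp hle, integral_congr_ae key, hfac]
    rfl

end RandomCurves

/-! ### Weak solutions carried by random curves -/

/-- The laws `μ(t)` of a random Lipschitz curve `γ` which follows `v` outside `ω` form a weak
solution of the continuity equation for the field `v + 𝟙_ω u`, where `u (x, t)` is the mean excess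
velocity `γ' - v(γ)` at time `t` given that `γ(t) = x`. -/
theorem exists_isWeakSolution_map {d : ℕ} {Ω : Type*} [MeasurableSpace Ω] (P : Measure Ω)
    [IsProbabilityMeasure P] {v : EuclideanSpace ℝ (Fin d) → EuclideanSpace ℝ (Fin d)}
    (hv : Measurable v) {M : ℝ} (hM : ∀ x, ‖v x‖ ≤ M) {ω : Set (EuclideanSpace ℝ (Fin d))}
    (hω : MeasurableSet ω) {T : ℝ} (hT : 0 ≤ T) {γ : Ω → ℝ → EuclideanSpace ℝ (Fin d)}
    (hγ : ∀ t, Measurable fun o => γ o t) {C : NNReal} (hC : ∀ o, LipschitzWith C (γ o))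
    (hout : ∀ᵐ o ∂P, ∀ t ∈ Ioo 0 T, γ o t ∉ ω → HasDerivAt (γ o) (v (γ o t)) t) :
    ∃ u : EuclideanSpace ℝ (Fin d) → ℝ → EuclideanSpace ℝ (Fin d),
      (Measurable fun p : EuclideanSpace ℝ (Fin d) × ℝ => localizedControl ω u p.1 p.2) ∧
      IsWeakSolution T (P.map fun o => γ o 0) (fun x t => v x + localizedControl ω u x t)
        fun t => P.map fun o => γ o t := by
  have hj : Measurable fun z : ℝ × Ω => γ z.2 z.1 :=
    measurable_uncurry_of_continuous_of_measurable (u := fun t o => γ o t)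
      (fun o => (hC o).continuous) hγ
  obtain ⟨b, hb, hbC, hbderiv⟩ := exists_measurable_velocity hj hC
  have hbae : ∀ o, ∀ᵐ t, HasDerivAt (γ o) (b (t, o)) t := fun o => by
    filter_upwards [(hC o).ae_differentiableAt_real] with t ht using hbderiv o t ht
  set m : Measure (ℝ × Ω) := (volume.restrict (Ioc 0 T)).prod P with hm
  let G : ℝ × Ω → EuclideanSpace ℝ (Fin d) × ℝ := fun z => (γ z.2 z.1, z.1)
  have hG : Measurable G := hj.prodMk measurable_fst
  have hvint : Integrable (fun z : ℝ × Ω => v (γ z.2 z.1)) m :=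
    Integrable.of_bound (hv.comp hj).aestronglyMeasurable M (ae_of_all _ fun z => hM _)
  have hbint : Integrable b m :=
    Integrable.of_bound hb.aestronglyMeasurable C (ae_of_all _ hbC)
  have hBint : Integrable (fun z : ℝ × Ω => b z - v (γ z.2 z.1)) m := hbint.sub hvint
  obtain ⟨u, hu, huint, hukey⟩ := exists_conditional_field m hG hBint
  have hcyl : MeasurableSet (ω ×ˢ univ : Set (EuclideanSpace ℝ (Fin d) × ℝ)) :=
    hω.prod MeasurableSet.univ
  have hloc : ∀ p : EuclideanSpace ℝ (Fin d) × ℝ,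
      localizedControl ω (fun x t => u (x, t)) p.1 p.2 = (ω ×ˢ univ).indicator u p := by
    rintro ⟨x, t⟩
    by_cases hx : x ∈ ω <;> simp [localizedControl, hx]
  have hlocm : Measurable fun p : EuclideanSpace ℝ (Fin d) × ℝ =>
      localizedControl ω (fun x t => u (x, t)) p.1 p.2 := by
    simp_rw [hloc]
    exact hu.indicator hcyl
  let w : EuclideanSpace ℝ (Fin d) → ℝ → EuclideanSpace ℝ (Fin d) :=
    fun x t => v x + localizedControl ω (fun x t => u (x, t)) x t
  have hw : Measurable fun p : EuclideanSpace ℝ (Fin d) × ℝ => w p.1 p.2 :=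
    (hv.comp measurable_fst).add hlocm
  have hwG : Measurable fun z : ℝ × Ω => w (γ z.2 z.1) z.1 := hw.comp hG
  have hwint : Integrable (fun z : ℝ × Ω => w (γ z.2 z.1) z.1) m := by
    refine hvint.add ?_
    have : (fun z : ℝ × Ω => localizedControl ω (fun x t => u (x, t)) (γ z.2 z.1) z.1) =
        (G ⁻¹' (ω ×ˢ univ)).indicator fun z => u (G z) := by
      funext z
      exact hloc (G z)
    rw [this]
    exact huint.indicator (hG hcyl)
  -- outside `ω` there is no excess velocity
  have hexcess : ∀ᵐ z ∂m, γ z.2 z.1 ∉ ω → b z = v (γ z.2 z.1) := by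
    have hmeas : MeasurableSet {z : ℝ × Ω | γ z.2 z.1 ∉ ω → b z = v (γ z.2 z.1)} := by
      have : {z : ℝ × Ω | γ z.2 z.1 ∉ ω → b z = v (γ z.2 z.1)} =
          (fun z : ℝ × Ω => γ z.2 z.1) ⁻¹' ω ∪ {z | b z = v (γ z.2 z.1)} := by
        ext z
        simp only [mem_ofPred_eq, mem_union, mem_preimage]
        tauto
      rw [this]
      exact (hj hω).union (measurableSet_eq_fun hb (hv.comp hj))
    rw [hm, Measure.ae_prod_iff_ae_ae hmeas, Measure.ae_ae_comm hmeas]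
    filter_upwards [hout] with o ho
    rw [← restrict_Ioo_eq_restrict_Ioc, ae_restrict_iff' measurableSet_Ioo]
    filter_upwards [hbae o] with t ht htT hto
    exact ht.unique (ho t htT hto)
  have hkey : ∀ (g : EuclideanSpace ℝ (Fin d) × ℝ → EuclideanSpace ℝ (Fin d)) (c : ℝ),
      Measurable g → (∀ y, ‖g y‖ ≤ c) →
        ∫ z, inner ℝ (g (G z)) (b z) ∂m = ∫ z, inner ℝ (g (G z)) (w (γ z.2 z.1) z.1) ∂m := by
    intro g c hg hc
    have hint : ∀ (g' : EuclideanSpace ℝ (Fin d) × ℝ → EuclideanSpace ℝ (Fin d))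
        (f : ℝ × Ω → EuclideanSpace ℝ (Fin d)), Measurable g' → (∀ y, ‖g' y‖ ≤ c) →
        Integrable f m → Integrable (fun z => inner ℝ (g' (G z)) (f z)) m := by
      intro g' f hg' hc' hf
      refine (hf.norm.const_mul c).mono'
        ((hg'.comp hG).aestronglyMeasurable.inner hf.aestronglyMeasurable) (ae_of_all _ fun z => ?_)
      exact (norm_inner_le_norm _ _).trans (by gcongr; exact hc' _)
    have hgω : Measurable ((ω ×ˢ univ).indicator g) := hg.indicator hcyl
    have hcω : ∀ y, ‖(ω ×ˢ univ).indicator g y‖ ≤ c := fun y =>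
      (norm_indicator_le_norm_self g y).trans (hc y)
    have h1 : ∀ᵐ z ∂m, inner ℝ (g (G z)) (b z) = inner ℝ (g (G z)) (v (γ z.2 z.1)) +
        inner ℝ ((ω ×ˢ univ).indicator g (G z)) (b z - v (γ z.2 z.1)) := by
      filter_upwards [hexcess] with z hz
      by_cases hzω : γ z.2 z.1 ∈ ω
      · rw [indicator_of_mem (show G z ∈ ω ×ˢ univ from ⟨hzω, mem_univ _⟩), ← inner_add_right,
          add_sub_cancel]
      · rw [hz hzω, sub_self, inner_zero_right, add_zero]
    have h2 : ∀ z, inner ℝ (g (G z)) (w (γ z.2 z.1) z.1) = inner ℝ (g (G z)) (v (γ z.2 z.1)) +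
        inner ℝ ((ω ×ˢ univ).indicator g (G z)) (u (G z)) := by
      intro z
      have : w (γ z.2 z.1) z.1 = v (γ z.2 z.1) + (ω ×ˢ univ).indicator u (G z) := by
        rw [← hloc (G z)]
      rw [this, inner_add_right]
      by_cases hzω : G z ∈ ω ×ˢ univ
      · rw [indicator_of_mem hzω, indicator_of_mem hzω]
      · rw [indicator_of_notMem hzω, indicator_of_notMem hzω, inner_zero_left, inner_zero_right]
    rw [integral_congr_ae h1, integral_congr_ae (ae_of_all _ h2),
      integral_add (hint g _ hg hc hvint) (hint _ _ hgω hcω hBint),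
      integral_add (hint g _ hg hc hvint) (hint _ _ hgω hcω huint), hukey _ c hgω hcω]
  -- integrals with respect to the laws are expectations
  have hmap : ∀ (t : ℝ) (f : EuclideanSpace ℝ (Fin d) → ℝ), Measurable f →
      ∫ x, f x ∂(P.map fun o => γ o t) = ∫ o, f (γ o t) ∂P := fun t f hf =>
    integral_map (hγ t).aemeasurable hf.aestronglyMeasurable
  refine ⟨fun x t => u (x, t), hlocm, hw, ?_, ?_, ?_, ?_, ?_, rfl⟩
  · intro t _
    exact Measure.isFiniteMeasure_map P _
  · have hlt := hwint.hasFiniteIntegral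
    rw [hasFiniteIntegral_iff_enorm, hm, lintegral_prod _ hwG.enorm.aemeasurable,
      restrict_Ioc_eq_restrict_Icc] at hlt
    refine lt_of_eq_of_lt (lintegral_congr fun t => ?_) hlt
    have hwt : Measurable fun x => w x t := hw.comp (measurable_id.prodMk measurable_const)
    exact lintegral_map hwt.enorm (hγ t)
  · intro ξ
    simp_rw [hmap _ ξ ξ.continuous.measurable]
    refine (continuous_of_dominated (bound := fun _ => ‖ξ‖)
      (fun t => (ξ.continuous.measurable.comp (hγ t)).aestronglyMeasurable)
      (fun t => ae_of_all _ fun o => ξ.norm_coe_le_norm _) (integrable_const _)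
      (ae_of_all _ fun o => ξ.continuous.comp (hC o).continuous)).continuousOn
  · rintro ξ ⟨K, hK⟩
    simp_rw [hmap _ ξ ξ.continuous.measurable]
    have hint : ∀ t, Integrable (fun o => ξ (γ o t)) P := fun t =>
      Integrable.of_bound (ξ.continuous.measurable.comp (hγ t)).aestronglyMeasurable ‖ξ‖
        (ae_of_all _ fun o => ξ.norm_coe_le_norm _)
    refine LipschitzOnWith.absolutelyContinuousOnInterval (K := K * C)
      (LipschitzWith.lipschitzOnWith (LipschitzWith.of_dist_le_mul fun s t => ?_))
    rw [dist_eq_norm, ← integral_sub (hint s) (hint t)]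
    refine (norm_integral_le_of_norm_le_const (ae_of_all _ fun o => ?_)).trans_eq
      (by rw [probReal_univ, mul_one])
    simpa [dist_eq_norm] using (hK.comp (hC o)).dist_le_mul s t
  · intro ψ hψ hsupp
    obtain ⟨K, hK⟩ := hψ.lipschitzWith_of_hasCompactSupport hsupp (by simp)
    have hψd : Differentiable ℝ ψ := hψ.differentiable (by simp)
    have hgc : Continuous (gradient ψ) :=
      (InnerProductSpace.toDual ℝ _).symm.continuous.comp (hψ.continuous_fderiv (by simp))
    have hgK : ∀ x, ‖gradient ψ x‖ ≤ K := fun x => by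
      rw [gradient, LinearIsometryEquiv.norm_map]
      exact norm_fderiv_le_of_lipschitz ℝ hK
    have hgj : Measurable fun z : ℝ × Ω => gradient ψ (γ z.2 z.1) := hgc.measurable.comp hj
    have hint : ∀ f : ℝ × Ω → EuclideanSpace ℝ (Fin d), Integrable f m →
        Integrable (fun z : ℝ × Ω => inner ℝ (gradient ψ (γ z.2 z.1)) (f z)) m := by
      intro f hf
      refine (hf.norm.const_mul (K : ℝ)).mono'
        (hgj.aestronglyMeasurable.inner hf.aestronglyMeasurable) (ae_of_all _ fun z => ?_)
      exact (norm_inner_le_norm _ _).trans (by gcongr; exact hgK _)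
    let H : ℝ → ℝ := fun t => ∫ o, inner ℝ (gradient ψ (γ o t)) (w (γ o t) t) ∂P
    have hHint : IntervalIntegrable H volume 0 T :=
      (intervalIntegrable_iff_integrableOn_Ioc_of_le hT).2 (hint _ hwint).integral_prod_left
    have hcut : ∀ t ∈ Icc 0 T, ∀ f : ℝ → ℝ,
        ∫ s in Ioc 0 T, (Iic t).indicator f s = ∫ s in (0 : ℝ)..t, f s := by
      intro t ht f
      rw [integral_indicator measurableSet_Iic, Measure.restrict_restrict measurableSet_Iic,
        intervalIntegral.integral_of_le ht.1]
      congr 2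
      ext s
      simp only [mem_inter_iff, mem_Iic, mem_Ioc]
      exact ⟨fun h => ⟨h.2.1, h.1⟩, fun h => ⟨h.2, h.1, h.2.trans ht.2⟩⟩
    have hψint : ∀ t, Integrable (fun o => ψ (γ o t)) P := by
      obtain ⟨c, hc⟩ := hsupp.exists_bound_of_continuous hψ.continuous
      exact fun t => Integrable.of_bound
        (hψ.continuous.measurable.comp (hγ t)).aestronglyMeasurable c (ae_of_all _ fun o => hc _)
    have hftc : ∀ o t, ∫ s in (0 : ℝ)..t, inner ℝ (gradient ψ (γ o s)) (b (s, o)) =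
        ψ (γ o t) - ψ (γ o 0) := by
      intro o t
      have hac : AbsolutelyContinuousOnInterval (fun s => ψ (γ o s)) 0 t :=
        ((hK.comp (hC o)).lipschitzOnWith).absolutelyContinuousOnInterval
      rw [← hac.integral_deriv_eq_sub]
      refine intervalIntegral.integral_congr_ae ?_
      filter_upwards [hbae o] with s hs _
      rw [inner_gradient_left]
      exact (((hψd (γ o s)).hasFDerivAt.comp_hasDerivAt s hs).deriv).symm
    have hprim : ∀ t ∈ Icc 0 T,
        ∫ o, ψ (γ o t) ∂P = ∫ o, ψ (γ o 0) ∂P + ∫ s in (0 : ℝ)..t, H s := by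
      intro t ht
      let g : EuclideanSpace ℝ (Fin d) × ℝ → EuclideanSpace ℝ (Fin d) :=
        (Prod.snd ⁻¹' Iic t).indicator fun p => gradient ψ p.1
      have hS : MeasurableSet (Prod.fst ⁻¹' Iic t : Set (ℝ × Ω)) := measurable_fst measurableSet_Iic
      have hg : Measurable g := (hgc.measurable.comp measurable_fst).indicator
        (measurable_snd measurableSet_Iic)
      have hgG : ∀ (f : ℝ × Ω → EuclideanSpace ℝ (Fin d)) (z : ℝ × Ω),
          inner ℝ (g (G z)) (f z) = (Prod.fst ⁻¹' Iic t : Set (ℝ × Ω)).indicator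
            (fun z => inner ℝ (gradient ψ (γ z.2 z.1)) (f z)) z := by
        intro f z
        by_cases hz : z.1 ≤ t <;> simp [g, G, indicator, hz]
      have h := hkey g K hg fun y => (norm_indicator_le_norm_self _ y).trans (hgK y.1)
      simp_rw [hgG b, hgG fun z => w (γ z.2 z.1) z.1] at h
      rw [hm, integral_prod_symm _ ((hint _ hbint).indicator hS),
        integral_prod _ ((hint _ hwint).indicator hS)] at h
      have hl : ∀ o, ∫ s in Ioc 0 T, (Prod.fst ⁻¹' Iic t : Set (ℝ × Ω)).indicator
          (fun z => inner ℝ (gradient ψ (γ z.2 z.1)) (b z)) (s, o) = ψ (γ o t) - ψ (γ o 0) := by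
        intro o
        rw [← hftc o t, ← hcut t ht]
        rfl
      have hr : ∀ s, ∫ o, (Prod.fst ⁻¹' Iic t : Set (ℝ × Ω)).indicator
          (fun z => inner ℝ (gradient ψ (γ z.2 z.1)) (w (γ z.2 z.1) z.1)) (s, o) ∂P =
            (Iic t).indicator H s := by
        intro s
        by_cases hs : s ≤ t <;> simp [indicator, hs, H]
      simp_rw [hl, hr] at h
      rw [hcut t ht, integral_sub (hψint t) (hψint 0)] at h
      linarith
    filter_upwards [hHint.ae_hasDerivAt_integral] with t ht htT
    simp_rw [hmap _ ψ hψ.continuous.measurable]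
    have hwt : Measurable fun x => w x t := hw.comp (measurable_id.prodMk measurable_const)
    rw [hmap t (fun x => inner ℝ (gradient ψ x) (w x t)) (hgc.measurable.inner hwt)]
    have hd := (ht (uIcc_of_le hT ▸ Ioo_subset_Icc_self htT) 0 left_mem_uIcc).const_add
      (∫ o, ψ (γ o 0) ∂P)
    refine hd.congr_of_eventuallyEq ?_
    filter_upwards [Ioo_mem_nhds htT.1 htT.2] with s hs
    exact hprim s (Ioo_subset_Icc_self hs)

/-! ### Lipschitz paths in open connected sets -/

section Paths

variable {E : Type*} [NormedAddCommGroup E] [NormedSpace ℝ E]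

theorem lipschitzWith_clamp (a : ℝ) : LipschitzWith 1 fun t : ℝ => max 0 (min t a) :=
  (LipschitzWith.id.min_const a).const_max 0

/-- Any two points of an open connected set are joined by a Lipschitz curve which never leaves
the set. The curve is defined for all times, so that no domain has to be carried along. -/
theorem exists_lipschitz_path {s : Set E} (hs : IsOpen s) (hc : IsPreconnected s) {x y : E}
    (hx : x ∈ s) (hy : y ∈ s) :
    ∃ (σ : ℝ → E) (C : NNReal), LipschitzWith C σ ∧ σ 0 = x ∧ σ 1 = y ∧ ∀ t, σ t ∈ s := by
  have clamp_mem : ∀ t : ℝ, max 0 (min t 1) ∈ Icc (0 : ℝ) 1 := fun t =>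
    ⟨le_max_left _ _, max_le zero_le_one (min_le_right _ _)⟩
  refine hc.induction₂' (fun x y => ∃ (σ : ℝ → E) (C : NNReal),
    LipschitzWith C σ ∧ σ 0 = x ∧ σ 1 = y ∧ ∀ t, σ t ∈ s) (fun x hx => ?_) ?_ hx hy
  · obtain ⟨r, hr, hball⟩ := Metric.isOpen_iff.1 hs x hx
    have line : ∀ a ∈ Metric.ball x r, ∀ b ∈ Metric.ball x r, ∃ (σ : ℝ → E) (C : NNReal),
        LipschitzWith C σ ∧ σ 0 = a ∧ σ 1 = b ∧ ∀ t, σ t ∈ s := by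
      intro a ha b hb
      refine ⟨fun t => AffineMap.lineMap a b (max 0 (min t 1)), _,
        (lipschitzWith_lineMap a b).comp (lipschitzWith_clamp 1), by simp, by simp, fun t => ?_⟩
      exact hball ((convex_ball x r).lineMap_mem ha hb (clamp_mem t))
    filter_upwards [mem_nhdsWithin_of_mem_nhds (Metric.ball_mem_nhds x hr)] with y hy
    exact ⟨line x (Metric.mem_ball_self hr) y hy, line y hy x (Metric.mem_ball_self hr)⟩
  · rintro x y z - - - ⟨σ, C, hσ, h0, h1, hmem⟩ ⟨τ, D, hτ, k0, k1, kmem⟩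
    have l1 : LipschitzWith 1 fun t : ℝ => max 0 (min t 1) := lipschitzWith_clamp 1
    have l2 : LipschitzWith 1 fun t : ℝ => t - 1 := by
      simpa using LipschitzWith.id.sub (LipschitzWith.const (1 : ℝ))
    have l3 : LipschitzWith 2 fun t : ℝ => 2 * t :=
      LipschitzWith.of_dist_le_mul fun a b => by
        rw [Real.dist_eq, Real.dist_eq, ← mul_sub, abs_mul]; norm_num
    -- run through `σ` and then through `τ`, each at double speed
    refine ⟨fun t => σ (max 0 (min (2 * t) 1)) + (τ (max 0 (min (2 * t - 1) 1)) - y), _,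
      (hσ.comp (l1.comp l3)).add
        ((hτ.comp (l1.comp (l2.comp l3))).sub (LipschitzWith.const y)), ?_, ?_, fun t => ?_⟩
    · norm_num [h0, k0]
    · norm_num [h1, k1]
    · beta_reduce
      rcases le_total (2 * t) 1 with h | h
      · rw [max_eq_left (a := (0 : ℝ)) (b := min (2 * t - 1) 1)
          ((min_le_left _ _).trans (by linarith)), k0, sub_self, add_zero]
        exact hmem _
      · rw [min_eq_right h, max_eq_right zero_le_one, h1, add_sub_cancel]
        exact kmem _

end Paths

/-! ### Steering compact sets to a point -/

section Steering

variable {E : Type*} [NormedAddCommGroup E] [NormedSpace ℝ E] [FiniteDimensional ℝ E]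

theorem continuous_flow {v : E → E} {K : NNReal} (hv : LipschitzWith K v) {M : ℝ}
    (hM : ∀ x, ‖v x‖ ≤ M) {t : ℝ} (ht : 0 ≤ t) : Continuous (flow v t) := by
  have hcomplete : CompleteSpace E := FiniteDimensional.complete ℝ E
  refine (LipschitzWith.of_dist_le_mul (K := (Real.exp (K * t)).toNNReal) fun x y => ?_).continuous
  have hd : ∀ x s, HasDerivAt (fun s => flow v s x) (v (flow v s x)) s :=
    fun x => (flow_spec hv hM x).2
  have := dist_le_of_trajectories_ODE (v := fun _ => v) (a := 0) (b := t) (δ := dist x y)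
    (fun _ => hv) (fun s _ => (hd x s).continuousAt.continuousWithinAt)
    (fun s _ => (hd x s).hasDerivWithinAt) (fun s _ => (hd y s).continuousAt.continuousWithinAt)
    (fun s _ => (hd y s).hasDerivWithinAt)
    (by rw [(flow_spec hv hM x).1, (flow_spec hv hM y).1]) t ⟨ht, le_rfl⟩
  rwa [sub_zero, mul_comm, ← Real.coe_toNNReal _ (Real.exp_pos _).le] at this

theorem lipschitzWith_flow {v : E → E} {K : NNReal} (hv : LipschitzWith K v) {M : ℝ}
    (hM : ∀ x, ‖v x‖ ≤ M) (x : E) : LipschitzWith M.toNNReal fun t => flow v t x := by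
  have hcomplete : CompleteSpace E := FiniteDimensional.complete ℝ E
  refine lipschitzWith_of_nnnorm_deriv_le
    (fun t => ((flow_spec hv hM x).2 t).differentiableAt) fun t => ?_
  rw [((flow_spec hv hM x).2 t).deriv]
  exact NNReal.le_toNNReal_of_coe_le (hM _)

theorem flow_neg {v : E → E} {K : NNReal} (hv : LipschitzWith K v) {M : ℝ}
    (hM : ∀ x, ‖v x‖ ≤ M) (t : ℝ) (x : E) : flow (fun y => -v y) t x = flow v (-t) x := by
  have hcomplete : CompleteSpace E := FiniteDimensional.complete ℝ E
  refine flow_eq (γ := fun s => flow v (-s) x) hv.neg ?_ (fun s => ?_) t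
  · simp [(flow_spec hv hM x).1]
  · simpa [Function.comp_def] using ((flow_spec hv hM x).2 (-s)).scomp s (hasDerivAt_neg s)

variable [MeasurableSpace E] [BorelSpace E]

/-- A family of curves `F x` steers the points `x ∈ s` to `p` within time `T`: the curves depend
measurably on `x`, are uniformly Lipschitz, and for `x ∈ s` the curve `F x` starts at `x`, follows
the field `v` at all positive times at which it is outside `ω`, and rests at `p` from time `T` on.
Resting at `p` allows `T` to be increased freely. -/
structure IsSteering (v : E → E) (ω : Set E) (p : E) (T : ℝ) (C : NNReal) (s : Set E)
    (F : E → ℝ → E) : Prop where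
  measurable : ∀ t, Measurable fun x => F x t
  lipschitz : ∀ x, LipschitzWith C (F x)
  start : ∀ x ∈ s, F x 0 = x
  rest : ∀ x ∈ s, ∀ t, T ≤ t → F x t = p
  follow : ∀ x ∈ s, ∀ t, 0 < t → F x t ∉ ω → HasDerivAt (F x) (v (F x t)) t

/-- If the flow of `v` brings `x` into the open connected set `ω`, then the points of a whole
neighbourhood of `x` can be steered to any `p ∈ ω`: let `x₁` near `x` flow for the time `t₀` that
brings `x` to `z ∈ ω`, then follow a path `σ` in `ω` from `z` to `p`, corrected by the vanishing
offset `(1 - s) • (flow v t₀ x₁ - z)`. -/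
theorem exists_isSteering_nhds {v : E → E} {K : NNReal} (hv : LipschitzWith K v) {M : ℝ}
    (hM : ∀ x, ‖v x‖ ≤ M) {ω : Set E} (hω : IsOpen ω) (hconn : IsPreconnected ω) {p : E}
    (hp : p ∈ ω) {x : E} {t₀ : ℝ} (ht₀ : 0 < t₀) (hx : flow v t₀ x ∈ ω) :
    ∃ s ∈ 𝓝 x, MeasurableSet s ∧ ∃ T C F, IsSteering v ω p T C s F := by
  have hcomplete : CompleteSpace E := FiniteDimensional.complete ℝ E
  set z := flow v t₀ x
  obtain ⟨σ, Cσ, hσ, h0, h1, hmem⟩ := exists_lipschitz_path hω hconn hx hp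
  have hclamp : ∀ t : ℝ, max 0 (min t 1) ∈ Icc (0 : ℝ) 1 := fun t =>
    ⟨le_max_left _ _, max_le zero_le_one (min_le_right _ _)⟩
  obtain ⟨δ, hδ, hthick⟩ := (isCompact_Icc.image hσ.continuous).exists_thickening_subset_open
    (s := σ '' Icc 0 1) hω (image_subset_iff.2 fun t _ => hmem t)
  let s : Set E := flow v t₀ ⁻¹' Metric.ball z δ
  have hs : IsOpen s := Metric.isOpen_ball.preimage (continuous_flow hv hM ht₀.le)
  let D : E → E := fun y => s.indicator (fun y => flow v t₀ y - z) y
  have hD : Measurable D :=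
    ((continuous_flow hv hM ht₀.le).measurable.sub_const z).indicator hs.measurableSet
  have hDδ : ∀ y, ‖D y‖ < δ := by
    intro y
    by_cases hy : y ∈ s
    · simp only [D, indicator_of_mem hy, ← dist_eq_norm]
      exact hy
    · simp [D, indicator_of_notMem hy, hδ]
  let F : E → ℝ → E := fun y t => flow v (max 0 (min t t₀)) y +
    (σ (max 0 (min (t - t₀) 1)) - z - max 0 (min (t - t₀) 1) • D y)
  have lshift : LipschitzWith 1 fun t : ℝ => max 0 (min (t - t₀) 1) := by
    simpa [Function.comp_def] using (lipschitzWith_clamp 1).comp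
      (LipschitzWith.id.sub (LipschitzWith.const t₀))
  have lD : ∀ y, LipschitzWith δ.toNNReal fun t : ℝ => t • D y := fun y =>
    LipschitzWith.of_dist_le_mul fun a b => by
      rw [dist_eq_norm, ← sub_smul, norm_smul, mul_comm, Real.coe_toNNReal _ hδ.le,
        Real.dist_eq, Real.norm_eq_abs]
      gcongr
      exact (hDδ y).le
  obtain ⟨CF, hCF⟩ : ∃ C, ∀ y, LipschitzWith C (F y) :=
    ⟨_, fun y => ((lipschitzWith_flow hv hM y).comp (lipschitzWith_clamp t₀)).add
      (((hσ.comp lshift).sub (LipschitzWith.const z)).sub ((lD y).comp lshift))⟩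
  have F_early : ∀ y, ∀ t ∈ Icc 0 t₀, F y t = flow v t y := by
    intro y t ht
    simp only [F]
    rw [min_eq_left ht.2, max_eq_right ht.1,
      max_eq_left ((min_le_left _ _).trans (sub_nonpos.2 ht.2)), h0]
    simp
  have F_late : ∀ y ∈ s, ∀ t, t₀ ≤ t → F y t = σ (max 0 (min (t - t₀) 1)) +
      (1 - max 0 (min (t - t₀) 1)) • D y := by
    intro y hy t ht
    simp only [F, D, indicator_of_mem hy]
    rw [min_eq_right ht, max_eq_right ht₀.le]
    module
  refine ⟨s, hs.mem_nhds (Metric.mem_ball_self hδ), hs.measurableSet, t₀ + 1, CF, F, ?_, ?_,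
    ?_, ?_, ?_⟩
  · intro t
    exact (continuous_flow hv hM (le_max_left _ _)).measurable.add
      (measurable_const.sub (hD.const_smul _))
  · exact hCF
  · intro y hy
    rw [F_early y 0 ⟨le_rfl, ht₀.le⟩, (flow_spec hv hM y).1]
  · intro y hy t ht
    rw [F_late y hy t (by linarith), min_eq_right (by linarith), max_eq_right zero_le_one, h1]
    simp
  · intro y hy t ht hout
    rcases lt_or_ge t t₀ with h | h
    · rw [F_early y t ⟨ht.le, h.le⟩]
      refine ((flow_spec hv hM y).2 t).congr_of_eventuallyEq ?_
      filter_upwards [Ioo_mem_nhds ht h] with r hr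
      exact F_early y r (Ioo_subset_Icc_self hr)
    · refine absurd (hthick ?_) hout
      rw [F_late y hy t h, Metric.mem_thickening_iff]
      refine ⟨_, mem_image_of_mem σ (hclamp (t - t₀)), ?_⟩
      obtain ⟨hr0, hr1⟩ := hclamp (t - t₀)
      rw [dist_eq_norm, add_sub_cancel_left, norm_smul, Real.norm_of_nonneg (by linarith)]
      refine (mul_le_of_le_one_left (norm_nonneg _) (by linarith)).trans_lt (hDδ y)

/-- A compact set each of whose points is brought into `ω` by the flow can be steered to
a point of `ω` in bounded time. -/
theorem exists_isSteering_of_isCompact {v : E → E} {K : NNReal} (hv : LipschitzWith K v) {M : ℝ}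
    (hM : ∀ x, ‖v x‖ ≤ M) {ω : Set E} (hω : IsOpen ω) (hconn : IsPreconnected ω) {p : E}
    (hp : p ∈ ω) {k : Set E} (hk : IsCompact k) (hflow : ∀ x ∈ k, ∃ t, 0 < t ∧ flow v t x ∈ ω) :
    ∃ T C F, IsSteering v ω p T C k F := by
  classical
  suffices h : ∃ s, k ⊆ s ∧ MeasurableSet s ∧ ∃ T C F, IsSteering v ω p T C s F by
    obtain ⟨s, hks, -, T, C, F, hF⟩ := h
    exact ⟨T, C, F, hF.measurable, hF.lipschitz, fun x hx => hF.start x (hks hx),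
      fun x hx => hF.rest x (hks hx), fun x hx => hF.follow x (hks hx)⟩
  refine hk.induction_on (p := fun k => ∃ s, k ⊆ s ∧ MeasurableSet s ∧
    ∃ T C F, IsSteering v ω p T C s F) ?_ ?_ ?_ ?_
  · exact ⟨∅, Subset.rfl, MeasurableSet.empty, 0, 0, fun _ _ => 0, fun _ => measurable_const,
      fun _ => LipschitzWith.const 0, by simp, by simp, by simp⟩
  · rintro k k' hkk' ⟨s, hs, h⟩
    exact ⟨s, hkk'.trans hs, h⟩
  · rintro k k' ⟨s, hks, hs, T, C, F, hF⟩ ⟨s', hks', hs', T', C', F', hF'⟩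
    have hin : ∀ x ∈ s, (if x ∈ s then F x else F' x) = F x := fun x hx => if_pos hx
    have hout : ∀ x ∉ s, (if x ∈ s then F x else F' x) = F' x := fun x hx => if_neg hx
    refine ⟨s ∪ s', union_subset_union hks hks', hs.union hs', max T T', max C C',
      fun x => if x ∈ s then F x else F' x, fun t => ?_, fun x => ?_, fun x hx => ?_,
      fun x hx t ht => ?_, fun x hx t ht hxt => ?_⟩
    · have : (fun x => (if x ∈ s then F x else F' x) t) =
          fun x => if x ∈ s then F x t else F' x t := by
        funext x
        split_ifs <;> rfl
      rw [this]
      exact Measurable.ite hs (hF.measurable t) (hF'.measurable t)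
    · by_cases h : x ∈ s
      · rw [hin x h]
        exact (hF.lipschitz x).weaken (le_max_left _ _)
      · rw [hout x h]
        exact (hF'.lipschitz x).weaken (le_max_right _ _)
    all_goals by_cases h : x ∈ s
    · rw [hin x h]
      exact hF.start x h
    · rw [hout x h]
      exact hF'.start x (hx.resolve_left h)
    · rw [hin x h]
      exact hF.rest x h t ((le_max_left _ _).trans ht)
    · rw [hout x h]
      exact hF'.rest x (hx.resolve_left h) t ((le_max_right _ _).trans ht)
    · rw [hin x h] at hxt ⊢
      exact hF.follow x h t ht hxt
    · rw [hout x h] at hxt ⊢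
      exact hF'.follow x (hx.resolve_left h) t ht hxt
  · intro x hx
    obtain ⟨t₀, ht₀, hxt⟩ := hflow x hx
    obtain ⟨s, hs, hsm, h⟩ := exists_isSteering_nhds hv hM hω hconn hp ht₀ hxt
    exact ⟨s, mem_nhdsWithin_of_mem_nhds hs, s, Subset.rfl, hsm, h⟩

end Steering

/-! ### Exact controllability -/

theorem theorem2 {d : ℕ} (hd : 1 ≤ d)
    (v : EuclideanSpace ℝ (Fin d) → EuclideanSpace ℝ (Fin d))
    (hv_lip : ∃ K : NNReal, LipschitzWith K v) (hv_bdd : ∃ C : ℝ, ∀ x, ‖v x‖ ≤ C)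
    (ω : Set (EuclideanSpace ℝ (Fin d))) (hω_open : IsOpen ω) (hω_conn : IsConnected ω)
    (μ₀ μ₁ : Measure (EuclideanSpace ℝ (Fin d)))
    [IsProbabilityMeasure μ₀] [IsProbabilityMeasure μ₁]
    (hμ₀ : IsCompact μ₀.support) (hμ₁ : IsCompact μ₁.support)
    (hcond : GeometricCondition v ω μ₀ μ₁) :
    ∃ T : ℝ, 0 < T ∧
      ∃ (u : EuclideanSpace ℝ (Fin d) → ℝ → EuclideanSpace ℝ (Fin d))
        (μ : ℝ → Measure (EuclideanSpace ℝ (Fin d))),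
        (Measurable fun p : EuclideanSpace ℝ (Fin d) × ℝ => localizedControl ω u p.1 p.2) ∧
        IsWeakSolution T μ₀ (fun x t => v x + localizedControl ω u x t) μ ∧
        μ T = μ₁ := by
  obtain ⟨K, hv⟩ := hv_lip
  obtain ⟨M, hM⟩ := hv_bdd
  obtain ⟨⟨p, hp⟩, hconn⟩ := hω_conn
  obtain ⟨T₀, C₀, F, hF⟩ := exists_isSteering_of_isCompact hv hM hω_open hconn hp hμ₀ hcond.1
  -- the points of the second support are steered to `p` backward in time, along `-v`
  obtain ⟨T₁, C₁, F', hF'⟩ := exists_isSteering_of_isCompact (v := fun x => -v x) hv.neg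
    (fun x => (norm_neg _).trans_le (hM x)) hω_open hconn hp hμ₁ fun x hx => by
      simpa only [flow_neg hv hM] using hcond.2 x hx
  let S := max T₀ 1
  let T := S + max T₁ 0
  have hS : 0 < S := zero_lt_one.trans_le (le_max_right _ _)
  have hT : 0 < T := add_pos_of_pos_of_nonneg hS (le_max_right _ _)
  have rest₀ : ∀ x ∈ μ₀.support, ∀ t, S ≤ t → F x t = p := fun x hx t ht =>
    hF.rest x hx t ((le_max_left _ _).trans ht)
  have rest₁ : ∀ y ∈ μ₁.support, ∀ t, t ≤ S → F' y (T - t) = p := fun y hy t ht =>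
    hF'.rest y hy _ ((le_max_left _ _).trans (by simp only [T]; linarith))
  -- `F x` rests at `p` after time `S`, and the reversed curve of `y` rests at `p` before it
  let γ : EuclideanSpace ℝ (Fin d) × EuclideanSpace ℝ (Fin d) → ℝ → EuclideanSpace ℝ (Fin d) :=
    fun q t => F q.1 t + (F' q.2 (T - t) - p)
  have early : ∀ q, q.2 ∈ μ₁.support → ∀ t, t ≤ S → γ q t = F q.1 t := fun q hq t ht => by
    simp only [γ, rest₁ _ hq t ht, sub_self, add_zero]
  have late : ∀ q, q.1 ∈ μ₀.support → ∀ t, S ≤ t → γ q t = F' q.2 (T - t) := fun q hq t ht => by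
    simp only [γ, rest₀ _ hq t ht, add_sub_cancel]
  have hsupp : ∀ᵐ q ∂μ₀.prod μ₁, q.1 ∈ μ₀.support ∧ q.2 ∈ μ₁.support := by
    filter_upwards [Measure.quasiMeasurePreserving_fst.ae Measure.support_mem_ae,
      Measure.quasiMeasurePreserving_snd.ae Measure.support_mem_ae] with q h₀ h₁
    exact ⟨h₀, h₁⟩
  have hγ : ∀ t, Measurable fun q => γ q t := fun t =>
    ((hF.measurable t).comp measurable_fst).add
      (((hF'.measurable (T - t)).comp measurable_snd).sub_const p)
  have hrev : LipschitzWith 1 fun t : ℝ => T - t := by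
    simpa using (LipschitzWith.const T).sub LipschitzWith.id
  have hγC : ∀ q, LipschitzWith (C₀ + (C₁ * 1 + 0)) (γ q) := fun q =>
    (hF.lipschitz q.1).add (((hF'.lipschitz q.2).comp hrev).sub (LipschitzWith.const p))
  have hout : ∀ᵐ q ∂μ₀.prod μ₁, ∀ t ∈ Ioo 0 T, γ q t ∉ ω → HasDerivAt (γ q) (v (γ q t)) t := by
    filter_upwards [hsupp] with q hq t ht hqt
    rcases lt_trichotomy t S with h | h | h
    · rw [early q hq.2 t h.le] at hqt ⊢
      refine (hF.follow q.1 hq.1 t ht.1 hqt).congr_of_eventuallyEq ?_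
      filter_upwards [Iio_mem_nhds h] with s hs using early q hq.2 s (le_of_lt hs)
    · rw [early q hq.2 t h.le, rest₀ q.1 hq.1 t h.ge] at hqt
      exact absurd hp hqt
    · rw [late q hq.1 t h.le] at hqt ⊢
      have h1 := (hF'.follow q.2 hq.2 (T - t) (sub_pos.2 ht.2) hqt).scomp t
        ((hasDerivAt_id t).const_sub T)
      rw [neg_one_smul, neg_neg] at h1
      refine h1.congr_of_eventuallyEq ?_
      filter_upwards [Ioi_mem_nhds h] with s hs using late q hq.1 s (le_of_lt hs)
  obtain ⟨u, hu, hsol⟩ := exists_isWeakSolution_map (μ₀.prod μ₁) hv.continuous.measurable hM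
    hω_open.measurableSet hT.le hγ hγC hout
  have hstart : (μ₀.prod μ₁).map (fun q => γ q 0) = μ₀ := by
    rw [Measure.map_congr (g := Prod.fst), Measure.map_fst_prod, measure_univ, one_smul]
    filter_upwards [hsupp] with q hq
    rw [early q hq.2 0 hS.le, hF.start q.1 hq.1]
  have hend : (μ₀.prod μ₁).map (fun q => γ q T) = μ₁ := by
    rw [Measure.map_congr (g := Prod.snd), Measure.map_snd_prod, measure_univ, one_smul]
    filter_upwards [hsupp] with q hq
    rw [late q hq.1 T (le_add_of_nonneg_right (le_max_right _ _)), sub_self,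
      hF'.start q.2 hq.2]
  rw [hstart] at hsol
  exact ⟨T, hT, u, _, hu, hsol, hend⟩
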